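/- Let $S$ be a non-empty finite set and let $p:2^S\to\mathbb Z\cup\{-\infty\}$ be supermodular, i.e. $p(\emptyset)=0$ and $p(X)+p(Y)\le p(X\cap Y)+p(X\cup Y)$ whenever $p(X),p(Y)$ are finite; assume that $p(S)$ is finite. For $x\in\mathbb Z^S$ and $Z\subseteq S$ write $x(Z)=\sum_{s\in Z}x(s)$, let $\chi_s$ be the unit vector of $s\in S$, and let $$\overset{\ldots}{B}(S,p)=\{x\in\mathbb Z^S:\ x(S)=p(S),\ x(Z)\ge p(Z)\ \text{for all } Z\subseteq S\}$$ be the M-convex set defined by $p$. The Fujishige-type decomposition algorithm, applied to $(S,p)$, determines a vector $z^*\in\mathbb Z^S$ as follows. 1. Set $a:=\lfloor p(S)/|S|\rfloor$. 2. Choose any $z\in\overset{\ldots}{B}(S,p)$ such that for all $s,t\in S$: if $z(s)\le a$, $z(t)\ge a+1$ and $z(t)\ge z(s)+2$, then $z+\chi_s-\chi_t\notin\overset{\ldots}{B}(S,p)$. 3. Put $S_+:=\bigcup_{t\in S:\,z(t)\ge a+2}\{s\in S: z+\chi_s-\chi_t\in\overset{\ldots}{B}(S,p)\}$, $\ S_-:=\bigcup_{s\in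 S:\,z(s)\le a-1}\{t\in S: z+\chi_s-\chi_t\in\overset{\ldots}{B}(S,p)\}$, $\ S_0:=S\setminus(S_+\cup S_-)$, and set $z^*(s):=z(s)$ for $s\in S_0$. 4. If $S_+\ne\emptyset$, determine $z^*$ on $S_+$ by applying the algorithm recursively to $(S_+,p_+)$, where $p_+(X)=p(X)$ for $X\subseteq S_+$. If $S_-\neq\emptyset$, determine $z^*$ on $S_-$ by applying the algorithm recursively to $(S_-,p_-)$, where $p_-(X)=p(X\cup(S\setminus S_-))-p(S\setminus S_-)$ for $X\subseteq S_-$. **Proposition.** The algorithm always terminates: whatever choices are made, in every call (initial or recursive) a vector $z$ as required in Step 2 exists, and the recursion is finite. It has an output $z^*$, and every output $z^*$ belongs to $\overset{\ldots}{B}(S,p)$ and minimizes the square-sum $W(x)=\sum_{s\in S}x(s)^2$ over $\overset{\ldots}{B}(S,p)$; equivalently, $z^*$ is a decreasingly minimal (dec-min) element of $\overset{\ldots}{B}(S,p)$, i.e. the vector of its components arranged in decreasing order is lexicographically smallest among all elements of $\overset{\ldots}{B}(S,p)$. -/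

import Mathlib

namespace FujishigeDecomposition

variable {S : Type*}

/-- An integer-valued supermodular set function `p` with `p ∅ = 0`, where the value `-∞` (that is
`⊥`) is allowed. As `⊥ + k = ⊥`, the inequality only says something when `p X` and `p Y` are
finite (and then the two values on the right are finite as well). -/
structure IsSupermodular [DecidableEq S] (p : Finset S → WithBot ℤ) : Prop where
  empty : p ∅ = 0
  supermodular : ∀ X Y : Finset S, p X + p Y ≤ p (X ∩ Y) + p (X ∪ Y)

/-- The integral elements of the base-polyhedron
`B'(p) = {x : x(T) = p(T), x(Z) ≥ p(Z) for all Z ⊆ T}` on the ground-set `T`.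
Only the components `x s` with `s ∈ T` and the values `p X` with `X ⊆ T` matter. -/
def integralBases (T : Finset S) (p : Finset S → WithBot ℤ) : Set (S → ℤ) :=
  {x | ((∑ s ∈ T, x s : ℤ) : WithBot ℤ) = p T ∧
    ∀ Z ⊆ T, p Z ≤ ((∑ s ∈ Z, x s : ℤ) : WithBot ℤ)}

/-- The number `a = ⌊p(T) / |T|⌋` (used only when `p T` is finite and `T` is non-empty). -/
def floorMean (T : Finset S) (p : Finset S → WithBot ℤ) : ℤ :=
  ⌊(((p T).unbotD 0 : ℤ) : ℚ) / (T.card : ℚ)⌋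

/-- The vector `z + χ_s - χ_t`. -/
def exchange [DecidableEq S] (z : S → ℤ) (s t : S) : S → ℤ :=
  z + Pi.single s 1 - Pi.single t 1

/-- The vectors that may be chosen at the beginning of a call on the ground-set `T`: those
`z ∈ integralBases T p` such that `z(s) ≤ a`, `z(t) ≥ a + 1`, `z(t) ≥ z(s) + 2` imply that
`z + χ_s - χ_t` is not an integral base, where `a = ⌊p(T) / |T|⌋`. -/
def IsChoice [DecidableEq S] (T : Finset S) (p : Finset S → WithBot ℤ) (z : S → ℤ) : Prop :=
  z ∈ integralBases T p ∧
    ∀ s ∈ T, ∀ t ∈ T, z s ≤ floorMean T p → floorMean T p + 1 ≤ z t → z s + 2 ≤ z t →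
      exchange z s t ∉ integralBases T p

open Classical in
/-- The set `S₊`: the union over all `t` with `z(t) ≥ a + 2` of
`{s : z + χ_s - χ_t is an integral base}`. -/
noncomputable def plusPart [DecidableEq S] (T : Finset S) (p : Finset S → WithBot ℤ)
    (z : S → ℤ) : Finset S :=
  T.filter fun s => ∃ t ∈ T, floorMean T p + 2 ≤ z t ∧ exchange z s t ∈ integralBases T p

open Classical in
/-- The set `S₋`: the union over all `s` with `z(s) ≤ a - 1` of
`{t : z + χ_s - χ_t is an integral base}`. -/
noncomputable def minusPart [DecidableEq S] (T : Finset S) (p : Finset S → WithBot ℤ)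
    (z : S → ℤ) : Finset S :=
  T.filter fun t => ∃ s ∈ T, z s ≤ floorMean T p - 1 ∧ exchange z s t ∈ integralBases T p

/-- The set `S₀ = T - (S₊ ∪ S₋)`. -/
noncomputable def zeroPart [DecidableEq S] (T : Finset S) (p : Finset S → WithBot ℤ)
    (z : S → ℤ) : Finset S :=
  T \ (plusPart T p z ∪ minusPart T p z)

/-- The function `X ↦ p(X ∪ (T - U)) - p(T - U)` on the subsets `X` of `U`, which describes the
contraction to `U ⊆ T` (used only when `p (T - U)` is finite). The restriction to a subset `U` is
described by `p` itself, on the ground-set `U`. -/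
def contraction [DecidableEq S] (T U : Finset S) (p : Finset S → WithBot ℤ) :
    Finset S → WithBot ℤ :=
  fun X => (p (X ∪ (T \ U))).map fun c => c - (p (T \ U)).unbotD 0

/-- `IsOutput T p zs`: some execution of the decomposition algorithm, called on the ground-set `T`
with the set function `p`, terminates and the components it has fixed on `T` are those of `zs`.
A call chooses `z`, sets `zs := z` on `S₀`, and calls the algorithm for the restriction to `S₊` and
for the contraction to `S₋`, whenever these sets are non-empty. -/
inductive IsOutput [DecidableEq S] :
    Finset S → (Finset S → WithBot ℤ) → (S → ℤ) → Prop
  | call {T : Finset S} {p : Finset S → WithBot ℤ} {zs : S → ℤ} (z : S → ℤ)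
      (choice : IsChoice T p z)
      (zero : ∀ s ∈ zeroPart T p z, zs s = z s)
      (plus : (plusPart T p z).Nonempty → IsOutput (plusPart T p z) p zs)
      (minus : (minusPart T p z).Nonempty →
        IsOutput (minusPart T p z) (contraction T (minusPart T p z) p) zs) :
      IsOutput T p zs

/-- `Terminates T p`: the call on `T` and `p` always terminates, whatever choices are made. The
required vector `z` exists in this call, and for every admissible `z` both recursive calls
terminate in the same sense. -/
inductive Terminates [DecidableEq S] : Finset S → (Finset S → WithBot ℤ) → Prop
  | call {T : Finset S} {p : Finset S → WithBot ℤ}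
      (exists_choice : ∃ z, IsChoice T p z)
      (plus : ∀ z, IsChoice T p z → (plusPart T p z).Nonempty → Terminates (plusPart T p z) p)
      (minus : ∀ z, IsChoice T p z → (minusPart T p z).Nonempty →
        Terminates (minusPart T p z) (contraction T (minusPart T p z) p)) :
      Terminates T p

/-- The square-sum `W(x) = ∑ x(s)²`. -/
def squareSum [Fintype S] (x : S → ℤ) : ℤ := ∑ s, x s ^ 2

/-- `m` is a minimizer of the square-sum over `Q`. -/
def IsSquareSumMin [Fintype S] (Q : Set (S → ℤ)) (m : S → ℤ) : Prop :=
  m ∈ Q ∧ ∀ x ∈ Q, squareSum m ≤ squareSum x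

/-- The components of `x` in decreasing order. -/
def sortedDecreasing [Fintype S] (x : S → ℤ) : List ℤ :=
  ((Finset.univ : Finset S).val.map x).sort (· ≥ ·)

/-- `m` is decreasingly minimal in `Q`: its largest component is as small as possible, within this
its second largest component is as small as possible, and so on. The order on lists is the
lexicographic one. -/
def IsDecMin [Fintype S] (Q : Set (S → ℤ)) (m : S → ℤ) : Prop :=
  m ∈ Q ∧ ∀ x ∈ Q, sortedDecreasing m ≤ sortedDecreasing x

end FujishigeDecomposition

/-! For a base `x`, the vector `x + χ_s - χ_t` is again a base iff every tight set containing `t`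
contains `s`. Tight sets form a lattice by supermodularity, so `S₊` and the complement of `S₋` are
tight (`isTight_of_separated`). The choice of `z` forces `z ≥ a + 1` on `S₊`, `z ≤ a` on `S₋` and `z
∈ {a, a + 1}` on `S₀`. As `a` is the floor of the mean, `S₊` and `S₋` are proper subsets, and the
recursion is finite.

The invariant for correctness is local optimality: no feasible exchange moves a unit from `t` to `s`
with `m s + 2 ≤ m t`. Such a base minimizes `∑ max (m s - c) 0` for every `c`
(`IsLocallyOptimal.sum_max_le`), which gives minimality of the square-sum and dec-minimality at
once. It also keeps the recursive outputs within the bounds that `z` satisfies on `S₊` and `S₋`.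
Hence in the glued vector, a base by `IsChoice.mem_integralBases_of_parts`, a feasible exchange
across a gap of two would lie inside `S₊` or inside `S₋`, against local optimality there. -/

namespace FujishigeDecomposition

/-! ### Tight sets, exchanges, restriction and contraction of bases. -/

section Bases

variable {S : Type*} {p : Finset S → WithBot ℤ} {T : Finset S}

/-- A subset of the ground-set on which the lower bound `p` is attained. -/
def IsTight (T : Finset S) (p : Finset S → WithBot ℤ) (x : S → ℤ) (Z : Finset S) : Prop :=
  Z ⊆ T ∧ p Z = ((∑ s ∈ Z, x s : ℤ) : WithBot ℤ)

lemma isTight_self {x : S → ℤ} (hx : x ∈ integralBases T p) : IsTight T p x T :=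
  ⟨subset_rfl, hx.1.symm⟩

lemma mem_integralBases_of_isTight {x : S → ℤ} (hx : x ∈ integralBases T p) {U : Finset S}
    (hU : IsTight T p x U) : x ∈ integralBases U p :=
  ⟨hU.2.symm, fun Z hZ => hx.2 Z (hZ.trans hU.1)⟩

variable [DecidableEq S]

lemma IsSupermodular.exists_le (hp : IsSupermodular p) {X Y : Finset S} {i j : ℤ}
    (hX : p X = i) (hY : p Y = j) :
    ∃ k l : ℤ, p (X ∩ Y) = k ∧ p (X ∪ Y) = l ∧ i + j ≤ k + l := by
  have h := hp.supermodular X Y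
  rw [hX, hY] at h
  cases hk : p (X ∩ Y) with
  | bot => rw [hk, WithBot.bot_add] at h; exact absurd (le_bot_iff.1 h) (by simp [← WithBot.coe_add])
  | coe k =>
    cases hl : p (X ∪ Y) with
    | bot =>
      rw [hl, WithBot.add_bot] at h; exact absurd (le_bot_iff.1 h) (by simp [← WithBot.coe_add])
    | coe l =>
      rw [hk, hl] at h
      exact ⟨k, l, rfl, rfl, by exact_mod_cast h⟩

/-- Uncrossing: `x` is modular and `p` supermodular, so neither lower bound can be slack. Only the
lower bounds are assumed, since `integralBases_nonempty` applies this to a vector not yet known to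
be a base. -/
lemma isTight_inter_union (hp : IsSupermodular p) {x : S → ℤ}
    (hx : ∀ Z ⊆ T, p Z ≤ ((∑ s ∈ Z, x s : ℤ) : WithBot ℤ)) {X Y : Finset S}
    (hX : IsTight T p x X) (hY : IsTight T p x Y) :
    IsTight T p x (X ∩ Y) ∧ IsTight T p x (X ∪ Y) := by
  obtain ⟨k, l, hk, hl, h⟩ := hp.exists_le hX.2 hY.2
  have hi : X ∩ Y ⊆ T := Finset.inter_subset_left.trans hX.1
  have hu : X ∪ Y ⊆ T := Finset.union_subset hX.1 hY.1
  have h1 := hx _ hi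
  have h2 := hx _ hu
  rw [hk, WithBot.coe_le_coe] at h1
  rw [hl, WithBot.coe_le_coe] at h2
  have h3 := Finset.sum_union_inter (s₁ := X) (s₂ := Y) (f := x)
  refine ⟨⟨hi, ?_⟩, ⟨hu, ?_⟩⟩
  · rw [hk, WithBot.coe_inj]; linarith
  · rw [hl, WithBot.coe_inj]; linarith

lemma isTight_empty (hp : IsSupermodular p) (x : S → ℤ) : IsTight T p x ∅ :=
  ⟨Finset.empty_subset _, by simp [hp.empty]⟩

/-- A set is tight as soon as its elements can be separated from the elements of its complement by
tight sets. -/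
lemma isTight_of_separated (hp : IsSupermodular p) {x : S → ℤ} (hx : x ∈ integralBases T p)
    {C : Finset S} (hC : C ⊆ T)
    (h : ∀ t ∈ C, ∀ s ∈ T \ C, ∃ Z, IsTight T p x Z ∧ t ∈ Z ∧ s ∉ Z) : IsTight T p x C := by
  have inner : ∀ t ∈ C, ∃ Z, IsTight T p x Z ∧ t ∈ Z ∧ Z ⊆ C := by
    intro t ht
    -- Intersecting the sets that separate `t` from each outside element leaves a tight set inside
    -- `C`; the union of these over `t` is `C`.
    have key : ∀ D ⊆ T \ C, ∃ Z, IsTight T p x Z ∧ t ∈ Z ∧ Disjoint Z D := by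
      intro D
      induction D using Finset.induction_on with
      | empty => exact fun _ => ⟨T, isTight_self hx, hC ht, Finset.disjoint_empty_right _⟩
      | insert s D _ ih =>
        intro hD
        obtain ⟨Z, hZ, htZ, hd⟩ := ih ((Finset.subset_insert _ _).trans hD)
        obtain ⟨Y, hY, htY, hs⟩ := h t ht s (hD (Finset.mem_insert_self _ _))
        refine ⟨Z ∩ Y, (isTight_inter_union hp hx.2 hZ hY).1, Finset.mem_inter.2 ⟨htZ, htY⟩, ?_⟩
        rw [Finset.disjoint_insert_right]
        exact ⟨fun h' => hs (Finset.mem_inter.1 h').2,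
          Finset.disjoint_of_subset_left Finset.inter_subset_left hd⟩
    obtain ⟨Z, hZ, htZ, hd⟩ := key _ subset_rfl
    refine ⟨Z, hZ, htZ, fun s hs => ?_⟩
    by_contra hsC
    exact Finset.disjoint_left.1 hd hs (Finset.mem_sdiff.2 ⟨hZ.1 hs, hsC⟩)
  have outer : ∀ E ⊆ C, ∃ Z, IsTight T p x Z ∧ E ⊆ Z ∧ Z ⊆ C := by
    intro E
    induction E using Finset.induction_on with
    | empty => exact fun _ => ⟨∅, isTight_empty hp x, subset_rfl, Finset.empty_subset _⟩
    | insert t E _ ih =>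
      intro hE
      obtain ⟨Z, hZ, hEZ, hZC⟩ := ih ((Finset.subset_insert _ _).trans hE)
      obtain ⟨Y, hY, htY, hYC⟩ := inner t (hE (Finset.mem_insert_self _ _))
      exact ⟨Y ∪ Z, (isTight_inter_union hp hx.2 hY hZ).2,
        Finset.insert_subset (Finset.mem_union_left _ htY)
          (hEZ.trans Finset.subset_union_right), Finset.union_subset hYC hZC⟩
  obtain ⟨Z, hZ, hCZ, hZC⟩ := outer C subset_rfl
  rwa [hCZ.antisymm hZC]

lemma sum_exchange (Z : Finset S) (z : S → ℤ) (s t : S) :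
    ∑ u ∈ Z, exchange z s t u
      = ∑ u ∈ Z, z u + (if s ∈ Z then 1 else 0) - (if t ∈ Z then 1 else 0) := by
  simp [exchange, Finset.sum_add_distrib, Finset.sum_sub_distrib]

@[simp]
lemma exchange_self (z : S → ℤ) (s : S) : exchange z s s = z := by simp [exchange]

/-- Only sets containing `t` but not `s` lose a unit, and by integrality a set that is not tight can
afford it. -/
lemma exchange_mem_iff {x : S → ℤ} (hx : x ∈ integralBases T p) {s t : S} (hs : s ∈ T)
    (ht : t ∈ T) :
    exchange x s t ∈ integralBases T p ↔ ∀ Z, IsTight T p x Z → t ∈ Z → s ∈ Z := by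
  constructor
  · intro h Z hZ htZ
    by_contra hsZ
    have h1 := h.2 Z hZ.1
    rw [hZ.2, sum_exchange, WithBot.coe_le_coe] at h1
    simp [htZ, hsZ] at h1
  · intro h
    refine ⟨?_, fun Z hZ => ?_⟩
    · rw [sum_exchange, ← hx.1]; simp [hs, ht]
    · rw [sum_exchange]
      have h1 := hx.2 Z hZ
      by_cases hsZ : s ∈ Z
      · refine h1.trans (WithBot.coe_le_coe.2 ?_)
        rw [if_pos hsZ]; split_ifs <;> linarith
      by_cases htZ : t ∈ Z
      · have h2 : p Z ≠ ((∑ u ∈ Z, x u : ℤ) : WithBot ℤ) := fun h' => hsZ (h Z ⟨hZ, h'⟩ htZ)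
        have h3 := lt_of_le_of_ne h1 h2
        rw [if_neg hsZ, if_pos htZ]
        cases hq : p Z with
        | bot => exact bot_le
        | coe k =>
          rw [hq, WithBot.coe_lt_coe] at h3
          rw [WithBot.coe_le_coe]; linarith
      · simpa [hsZ, htZ] using h1

lemma exists_isTight_of_exchange_notMem {x : S → ℤ} (hx : x ∈ integralBases T p) {s t : S}
    (hs : s ∈ T) (ht : t ∈ T) (h : exchange x s t ∉ integralBases T p) :
    ∃ Z, IsTight T p x Z ∧ t ∈ Z ∧ s ∉ Z := by
  rw [exchange_mem_iff hx hs ht] at h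
  push Not at h
  exact h

/-- The elements that can be increased in exchange for an element of `A` form a tight set. -/
lemma isTight_of_mem_iff_exists_exchange (hp : IsSupermodular p) {x : S → ℤ}
    (hx : x ∈ integralBases T p) {A C : Finset S} (hA : A ⊆ T)
    (hC : ∀ s, s ∈ C ↔ s ∈ T ∧ ∃ t ∈ A, exchange x s t ∈ integralBases T p) :
    IsTight T p x C := by
  refine isTight_of_separated hp hx (fun s hs => ((hC s).1 hs).1) fun t ht s hs => ?_
  obtain ⟨htT, u, hu, hex⟩ := (hC t).1 ht
  obtain ⟨hsT, hsC⟩ := Finset.mem_sdiff.1 hs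
  obtain ⟨Z, hZ, huZ, hsZ⟩ := exists_isTight_of_exchange_notMem hx hsT (hA hu)
    fun h => hsC ((hC s).2 ⟨hsT, u, hu, h⟩)
  exact ⟨Z, hZ, (exchange_mem_iff hx htT (hA hu)).1 hex Z hZ huZ, hsZ⟩

/-- The elements that cannot be decreased in exchange for an element of `A` form a tight set. -/
lemma isTight_sdiff_of_mem_iff_exists_exchange (hp : IsSupermodular p) {x : S → ℤ}
    (hx : x ∈ integralBases T p) {A C : Finset S} (hA : A ⊆ T)
    (hC : ∀ t, t ∈ C ↔ t ∈ T ∧ ∃ s ∈ A, exchange x s t ∈ integralBases T p) :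
    IsTight T p x (T \ C) := by
  refine isTight_of_separated hp hx Finset.sdiff_subset fun t ht s hs => ?_
  obtain ⟨htT, htC⟩ := Finset.mem_sdiff.1 ht
  have hsC : s ∈ C := by
    by_contra h
    exact (Finset.mem_sdiff.1 hs).2 (Finset.mem_sdiff.2 ⟨(Finset.mem_sdiff.1 hs).1, h⟩)
  obtain ⟨hsT, v, hv, hex⟩ := (hC s).1 hsC
  obtain ⟨Z, hZ, htZ, hvZ⟩ := exists_isTight_of_exchange_notMem hx (hA hv) htT
    fun h => htC ((hC t).2 ⟨htT, v, hv, h⟩)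
  exact ⟨Z, hZ, htZ, fun hsZ => hvZ ((exchange_mem_iff hx (hA hv) hsT).1 hex Z hZ hsZ)⟩

/-- Take `x` with least total among the vectors satisfying the lower bounds. No component can be
decreased, so tight sets cover `T`, and their union `T` is tight. -/
lemma integralBases_nonempty (hp : IsSupermodular p) (hT : p T ≠ ⊥) :
    (integralBases T p).Nonempty := by
  obtain ⟨k, hk⟩ := WithBot.ne_bot_iff_exists.1 hT
  let F : Set (S → ℤ) := {x | ∀ Z ⊆ T, p Z ≤ ((∑ s ∈ Z, x s : ℤ) : WithBot ℤ)}
  have hF : F.Nonempty := by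
    let M : ℤ := ∑ Z ∈ T.powerset, |(p Z).unbotD 0|
    refine ⟨fun _ => M, fun Z hZ => ?_⟩
    rcases Z.eq_empty_or_nonempty with rfl | hne
    · simp [hp.empty]
    cases hq : p Z with
    | bot => exact bot_le
    | coe j =>
      rw [WithBot.coe_le_coe]
      have h1 : |(p Z).unbotD 0| ≤ M :=
        Finset.single_le_sum (f := fun Z => |(p Z).unbotD 0|) (fun _ _ => abs_nonneg _)
          (Finset.mem_powerset.2 hZ)
      rw [hq, WithBot.unbotD_coe] at h1
      have h2 : (1 : ℤ) ≤ Z.card := by exact_mod_cast hne.card_pos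
      have h3 := le_abs_self j
      have h4 := abs_nonneg j
      rw [Finset.sum_const, nsmul_eq_mul]
      nlinarith
  have hbound : ∀ x ∈ F, k ≤ ∑ s ∈ T, x s := by
    intro x hx
    have := hx T subset_rfl
    rwa [← hk, WithBot.coe_le_coe] at this
  obtain ⟨x, hx, hmin⟩ : ∃ x ∈ F, ∀ y ∈ F, ∑ s ∈ T, x s ≤ ∑ s ∈ T, y s := by
    obtain ⟨x, hx, hmin⟩ := WellFounded.has_min
      (InvImage.wf (fun x : S → ℤ => (∑ s ∈ T, x s - k).toNat) wellFounded_lt) F hF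
    refine ⟨x, hx, fun y hy => ?_⟩
    have h1 : ¬ (∑ s ∈ T, y s - k).toNat < (∑ s ∈ T, x s - k).toNat := hmin y hy
    have h2 := hbound x hx
    have h3 := hbound y hy
    omega
  have hcover : ∀ s ∈ T, ∃ Z, IsTight T p x Z ∧ s ∈ Z := by
    intro s hs
    by_contra! hno
    have hy : x - Pi.single s 1 ∈ F := by
      intro Z hZ
      have h1 := hx Z hZ
      have h2 : ∑ u ∈ Z, (x - Pi.single s 1 : S → ℤ) u = ∑ u ∈ Z, x u - (if s ∈ Z then 1 else 0) := by
        simp [Finset.sum_sub_distrib]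
      rw [h2]
      by_cases hsZ : s ∈ Z
      · have h3 := lt_of_le_of_ne h1 fun h' => hno Z ⟨hZ, h'⟩ hsZ
        rw [if_pos hsZ]
        cases hq : p Z with
        | bot => exact bot_le
        | coe k =>
          rw [hq, WithBot.coe_lt_coe] at h3
          rw [WithBot.coe_le_coe]; linarith
      · simpa [hsZ] using h1
    have h4 := hmin _ hy
    simp [Finset.sum_sub_distrib, hs] at h4
  have hE : ∀ E ⊆ T, ∃ Z, IsTight T p x Z ∧ E ⊆ Z := by
    intro E
    induction E using Finset.induction_on with
    | empty => exact fun _ => ⟨∅, isTight_empty hp x, subset_rfl⟩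
    | insert t E _ ih =>
      intro hE
      obtain ⟨Z, hZ, hEZ⟩ := ih ((Finset.subset_insert _ _).trans hE)
      obtain ⟨Y, hY, htY⟩ := hcover t (hE (Finset.mem_insert_self _ _))
      exact ⟨Y ∪ Z, (isTight_inter_union hp hx hY hZ).2,
        Finset.insert_subset (Finset.mem_union_left _ htY)
          (hEZ.trans Finset.subset_union_right)⟩
  obtain ⟨Z, hZ, hTZ⟩ := hE T subset_rfl
  obtain rfl : Z = T := hZ.1.antisymm hTZ
  exact ⟨x, hZ.2.symm, hx⟩

lemma isSupermodular_contraction (hp : IsSupermodular p) {U : Finset S} (hU : p (T \ U) ≠ ⊥) :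
    IsSupermodular (contraction T U p) := by
  obtain ⟨r, hr⟩ := WithBot.ne_bot_iff_exists.1 hU
  refine ⟨?_, fun X Y => ?_⟩
  · simp [contraction, ← hr]
  · simp only [contraction, ← hr, WithBot.unbotD_coe]
    cases hX : p (X ∪ T \ U) with
    | bot => simp
    | coe i =>
      cases hY : p (Y ∪ T \ U) with
      | bot => simp
      | coe j =>
        obtain ⟨k, l, hk, hl, h⟩ := hp.exists_le hX hY
        rw [← Finset.inter_union_distrib_right] at hk
        rw [← Finset.union_union_distrib_right] at hl
        rw [hk, hl]
        simp only [WithBot.map_coe, ← WithBot.coe_add, WithBot.coe_le_coe]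
        linarith

lemma mem_integralBases_contraction {x : S → ℤ} (hx : x ∈ integralBases T p) {U : Finset S}
    (hUT : U ⊆ T) (hU : IsTight T p x (T \ U)) : x ∈ integralBases U (contraction T U p) := by
  refine ⟨?_, fun Z hZ => ?_⟩
  · rw [contraction, Finset.union_sdiff_of_subset hUT, hU.2, ← hx.1, WithBot.unbotD_coe,
      WithBot.map_coe, ← Finset.sum_sdiff hUT]
    simp
  · have h1 := hx.2 (Z ∪ T \ U) (Finset.union_subset (hZ.trans hUT) Finset.sdiff_subset)
    have hd : Disjoint Z (T \ U) := Finset.disjoint_of_subset_left hZ Finset.disjoint_sdiff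
    rw [Finset.sum_union hd] at h1
    rw [contraction, hU.2, WithBot.unbotD_coe]
    cases hq : p (Z ∪ T \ U) with
    | bot => simp
    | coe k =>
      rw [hq, WithBot.coe_le_coe] at h1
      rw [WithBot.map_coe, WithBot.coe_le_coe]
      linarith

end Bases

/-! ### Least majorization, and its consequences for square-sums and decreasing order. -/

section Majorization

variable {S : Type*} {p : Finset S → WithBot ℤ} {T : Finset S}

lemma two_mul_sum_max (K : ℕ) : ∀ k : ℤ, 0 ≤ k → k ≤ K →
    2 * ∑ i ∈ Finset.range K, max (k - 1 - i) 0 = k ^ 2 - k := by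
  induction K with
  | zero =>
    intro k h0 hk
    obtain rfl : k = 0 := le_antisymm (by simpa using hk) h0
    simp
  | succ K ih =>
    intro k h0 hk
    push_cast at hk
    rcases hk.eq_or_lt with rfl | hlt
    · have h1 := ih K (by positivity) le_rfl
      rw [Finset.sum_range_succ']
      have h2 : ∑ i ∈ Finset.range K, max ((K : ℤ) + 1 - 1 - ((i + 1 : ℕ) : ℤ)) 0
          = ∑ i ∈ Finset.range K, max ((K : ℤ) - 1 - i) 0 :=
        Finset.sum_congr rfl fun i _ => by push_cast; congr 1; ring
      rw [h2, mul_add, h1]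
      simp
      ring
    · rw [Finset.sum_range_succ, max_eq_right (by linarith), add_zero, ih k h0 (by linarith)]

/-- On a bounded range of integers the square is an affine function plus a nonnegative combination
of the functions `max (x - c) 0`. -/
lemma sum_sq_le_of_sum_max_le {m y : S → ℤ} (h0 : ∑ s ∈ T, m s = ∑ s ∈ T, y s)
    (h : ∀ c, ∑ s ∈ T, max (m s - c) 0 ≤ ∑ s ∈ T, max (y s - c) 0) :
    ∑ s ∈ T, m s ^ 2 ≤ ∑ s ∈ T, y s ^ 2 := by
  obtain ⟨N, hN⟩ : ∃ N : ℕ, ∀ s ∈ T, |m s| ≤ N ∧ |y s| ≤ N := by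
    refine ⟨∑ s ∈ T, ((m s).natAbs + (y s).natAbs), fun s hs => ?_⟩
    have := Finset.single_le_sum (f := fun s => (m s).natAbs + (y s).natAbs)
      (fun _ _ => Nat.zero_le _) hs
    rw [Int.abs_eq_natAbs, Int.abs_eq_natAbs]
    omega
  have expand : ∀ x : S → ℤ, (∀ s ∈ T, |x s| ≤ N) → ∑ s ∈ T, x s ^ 2
      = 2 * ∑ i ∈ Finset.range (2 * N), ∑ s ∈ T, max (x s - (1 + i - N)) 0
        + (1 - 2 * N) * ∑ s ∈ T, x s + ∑ s ∈ T, ((N : ℤ) - N ^ 2) := by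
    intro x hx
    rw [Finset.sum_comm, Finset.mul_sum, Finset.mul_sum, ← Finset.sum_add_distrib,
      ← Finset.sum_add_distrib]
    refine Finset.sum_congr rfl fun s hs => ?_
    have hb := abs_le.1 (hx s hs)
    -- The shift by `N` moves the values into `[0, 2N]`.
    have h1 := two_mul_sum_max (2 * N) (x s + N) (by linarith) (by push_cast; linarith)
    have h2 : ∑ i ∈ Finset.range (2 * N), max (x s - (1 + (i : ℤ) - N)) 0
        = ∑ i ∈ Finset.range (2 * N), max (x s + N - 1 - (i : ℤ)) 0 :=
      Finset.sum_congr rfl fun i _ => by congr 1; ring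
    rw [h2, h1]
    ring
  rw [expand m fun s hs => (hN s hs).1, expand y fun s hs => (hN s hs).2, h0]
  have := Finset.sum_le_sum fun (i : ℕ) (_ : i ∈ Finset.range (2 * N)) => h (1 + i - N)
  linarith

/-- Equal heads cancel for every `c`. If the first difference has `a > b`, the threshold `c = b`
makes the right sum zero and the left one positive. -/
lemma list_le_of_sum_max_le : ∀ {l₁ l₂ : List ℤ}, l₁.length = l₂.length →
    l₁.Pairwise (· ≥ ·) → l₂.Pairwise (· ≥ ·) →
    (∀ c, (l₁.map fun x => max (x - c) 0).sum ≤ (l₂.map fun x => max (x - c) 0).sum) → l₁ ≤ l₂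
  | [], [], _, _, _, _ => le_rfl
  | a :: l₁, b :: l₂, hlen, h₁, h₂, h => by
    rcases lt_trichotomy a b with hab | rfl | hab
    · exact le_of_lt (List.Lex.rel hab)
    · have ih : l₁ ≤ l₂ := list_le_of_sum_max_le (by simpa using hlen) (List.pairwise_cons.1 h₁).2
        (List.pairwise_cons.1 h₂).2 fun c => by
          have := h c
          simp only [List.map_cons, List.sum_cons] at this
          linarith
      rcases ih.lt_or_eq with hlt | rfl
      · exact le_of_lt (List.Lex.cons hlt)
      · exact le_rfl
    · exfalso
      have h3 := h b
      have h4 : ((b :: l₂).map fun x => max (x - b) 0).sum = 0 := by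
        refine List.sum_eq_zero fun v hv => ?_
        obtain ⟨x, hx, rfl⟩ := List.mem_map.1 hv
        rcases List.mem_cons.1 hx with rfl | hx
        · simp
        · exact max_eq_right (by have := (List.pairwise_cons.1 h₂).1 x hx; linarith)
      have h5 : 0 ≤ (l₁.map fun x => max (x - b) 0).sum := by
        refine List.sum_nonneg fun v hv => ?_
        obtain ⟨x, hx, rfl⟩ := List.mem_map.1 hv
        exact le_max_right _ _
      rw [h4, List.map_cons, List.sum_cons, max_eq_left (by linarith)] at h3
      linarith

lemma sum_map_sortedDecreasing [Fintype S] (x : S → ℤ) (f : ℤ → ℤ) :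
    ((sortedDecreasing x).map f).sum = ∑ s, f (x s) := by
  rw [← Multiset.sum_coe, ← Multiset.map_coe, sortedDecreasing, Multiset.sort_eq,
    Multiset.map_map]
  rfl

variable [DecidableEq S]

/-- An integral base that no exchange between components differing by at least two improves. -/
def IsLocallyOptimal (T : Finset S) (p : Finset S → WithBot ℤ) (m : S → ℤ) : Prop :=
  m ∈ integralBases T p ∧
    ∀ s ∈ T, ∀ t ∈ T, m s + 2 ≤ m t → exchange m s t ∉ integralBases T p

open Classical in
/-- A locally optimal base is least majorized. -/
lemma IsLocallyOptimal.sum_max_le (hp : IsSupermodular p) {m y : S → ℤ}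
    (hm : IsLocallyOptimal T p m) (hy : y ∈ integralBases T p) (c : ℤ) :
    ∑ s ∈ T, max (m s - c) 0 ≤ ∑ s ∈ T, max (y s - c) 0 := by
  -- `C` is a tight set with `m ≥ c` inside and `m ≤ c` outside, so the excess of `m` over `c` is `p
  -- C - c * |C|`, a lower bound for the excess of every base.
  let A := T.filter fun t => c + 1 ≤ m t
  let C := T.filter fun s => ∃ t ∈ A, exchange m s t ∈ integralBases T p
  have hC : IsTight T p m C := isTight_of_mem_iff_exists_exchange hp hm.1
    (Finset.filter_subset _ _) fun s => Finset.mem_filter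
  have hge : ∀ s ∈ C, c ≤ m s := by
    intro s hs
    obtain ⟨hsT, t, ht, hex⟩ := Finset.mem_filter.1 hs
    obtain ⟨htT, htc⟩ := Finset.mem_filter.1 ht
    by_contra! hlt
    exact hm.2 s hsT t htT (by linarith) hex
  have hle : ∀ s ∈ T, s ∉ C → m s ≤ c := by
    intro s hs hsC
    by_contra! hlt
    exact hsC (Finset.mem_filter.2 ⟨hs, s, Finset.mem_filter.2 ⟨hs, hlt⟩, by
      rw [exchange_self]; exact hm.1⟩)
  have h1 : ∑ s ∈ C, m s ≤ ∑ s ∈ C, y s := by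
    have := hy.2 C hC.1
    rwa [hC.2, WithBot.coe_le_coe] at this
  calc ∑ s ∈ T, max (m s - c) 0 = ∑ s ∈ C, max (m s - c) 0 :=
        (Finset.sum_subset hC.1 fun s hs hsC => max_eq_right (by linarith [hle s hs hsC])).symm
    _ = ∑ s ∈ C, (m s - c) :=
        Finset.sum_congr rfl fun s hs => max_eq_left (by linarith [hge s hs])
    _ ≤ ∑ s ∈ C, (y s - c) := by simp only [Finset.sum_sub_distrib]; linarith
    _ ≤ ∑ s ∈ C, max (y s - c) 0 := Finset.sum_le_sum fun s _ => le_max_left _ _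
    _ ≤ ∑ s ∈ T, max (y s - c) 0 :=
        Finset.sum_le_sum_of_subset_of_nonneg hC.1 fun _ _ _ => le_max_right _ _

lemma IsLocallyOptimal.le_of_forall_le (hp : IsSupermodular p) {m y : S → ℤ}
    (hm : IsLocallyOptimal T p m) (hy : y ∈ integralBases T p) {c : ℤ} (hc : ∀ s ∈ T, y s ≤ c) :
    ∀ s ∈ T, m s ≤ c := by
  intro s hs
  have h1 := hm.sum_max_le hp hy c
  rw [Finset.sum_eq_zero (f := fun s => max (y s - c) 0)
    fun s hs => max_eq_right (by linarith [hc s hs])] at h1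
  have h2 := Finset.single_le_sum (f := fun s => max (m s - c) 0) (fun _ _ => le_max_right _ _) hs
  have h3 := le_max_left (m s - c) 0
  linarith

/-- As the totals agree, comparing excesses over `c` also compares the deficits `max (m s - c) 0 -
(m s - c)`. -/
lemma IsLocallyOptimal.ge_of_forall_ge (hp : IsSupermodular p) {m y : S → ℤ}
    (hm : IsLocallyOptimal T p m) (hy : y ∈ integralBases T p) {c : ℤ} (hc : ∀ s ∈ T, c ≤ y s) :
    ∀ s ∈ T, c ≤ m s := by
  intro s hs
  have h1 := hm.sum_max_le hp hy c
  rw [Finset.sum_congr rfl fun s hs => max_eq_left (by linarith [hc s hs] : 0 ≤ y s - c)] at h1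
  have h0 : ∑ s ∈ T, m s = ∑ s ∈ T, y s := WithBot.coe_inj.1 (hm.1.1.trans hy.1.symm)
  have h2 : ∑ s ∈ T, (max (m s - c) 0 - (m s - c)) ≤ 0 := by
    simp only [Finset.sum_sub_distrib] at h1 ⊢
    linarith
  have h3 := Finset.single_le_sum (f := fun s => max (m s - c) 0 - (m s - c))
    (fun u _ => sub_nonneg.2 (le_max_left _ _)) hs
  have h4 := le_max_right (m s - c) 0
  linarith

lemma IsLocallyOptimal.isSquareSumMin [Fintype S] (hp : IsSupermodular p) {m : S → ℤ}
    (hm : IsLocallyOptimal Finset.univ p m) :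
    IsSquareSumMin (integralBases Finset.univ p) m :=
  ⟨hm.1, fun _ hy => sum_sq_le_of_sum_max_le (WithBot.coe_inj.1 (hm.1.1.trans hy.1.symm))
    (hm.sum_max_le hp hy)⟩

lemma IsLocallyOptimal.isDecMin [Fintype S] (hp : IsSupermodular p) {m : S → ℤ}
    (hm : IsLocallyOptimal Finset.univ p m) : IsDecMin (integralBases Finset.univ p) m := by
  refine ⟨hm.1, fun y hy => list_le_of_sum_max_le ?_ (Multiset.pairwise_sort _ _)
    (Multiset.pairwise_sort _ _) fun c => ?_⟩
  · simp [sortedDecreasing]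
  · rw [sum_map_sortedDecreasing m fun x => max (x - c) 0,
      sum_map_sortedDecreasing y fun x => max (x - c) 0]
    exact hm.sum_max_le hp hy c

end Majorization

/-! ### Existence of choices, termination, gluing and correctness. -/

section Algorithm

variable {S : Type*} {p : Finset S → WithBot ℤ} {T : Finset S}

lemma floorMean_mul_card_le {k : ℤ} (hk : p T = k) (hT : T.Nonempty) :
    floorMean T p * T.card ≤ k ∧ k < (floorMean T p + 1) * T.card := by
  have hc : (0 : ℚ) < T.card := by exact_mod_cast hT.card_pos
  have h1 := Int.floor_le (((p T).unbotD 0 : ℤ) / (T.card : ℚ) : ℚ)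
  have h2 := Int.lt_floor_add_one (((p T).unbotD 0 : ℤ) / (T.card : ℚ) : ℚ)
  rw [le_div_iff₀ hc] at h1
  rw [div_lt_iff₀ hc] at h2
  rw [show ⌊(((p T).unbotD 0 : ℤ) / (T.card : ℚ) : ℚ)⌋ = floorMean T p from rfl, hk,
    WithBot.unbotD_coe] at h1 h2
  exact ⟨by exact_mod_cast h1, by exact_mod_cast h2⟩

variable [DecidableEq S]

/-- A base of least square-sum works: an exchange across a gap of two changes it by `2 * (z s - z t
+ 1) < 0`. -/
lemma exists_isChoice (hp : IsSupermodular p) (hT : p T ≠ ⊥) : ∃ z, IsChoice T p z := by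
  obtain ⟨z, hz, hmin⟩ := WellFounded.has_min
    (InvImage.wf (fun x : S → ℤ => (∑ s ∈ T, x s ^ 2).toNat) wellFounded_lt) _
    (integralBases_nonempty hp hT)
  refine ⟨z, hz, fun s hs t ht _ _ hst hex => hmin _ hex ?_⟩
  have hne : s ≠ t := by rintro rfl; linarith
  have h1 : ∑ u ∈ T, (exchange z s t u ^ 2 - z u ^ 2)
      = (2 * z s + 1) + (1 - 2 * z t) := by
    have h2 : ∀ u, exchange z s t u ^ 2 - z u ^ 2
        = Pi.single (M := fun _ => ℤ) s (2 * z s + 1) u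
          + Pi.single (M := fun _ => ℤ) t (1 - 2 * z t) u := by
      intro u
      by_cases hus : u = s
      · subst hus
        simp [exchange, hne]; ring
      by_cases hut : u = t
      · subst hut
        simp [exchange, hus]; ring
      · simp [exchange, hus, hut]
    simp only [h2, Finset.sum_add_distrib, Finset.sum_pi_single', hs, ht, if_true]
  rw [Finset.sum_sub_distrib] at h1
  have h3 : 0 ≤ ∑ u ∈ T, exchange z s t u ^ 2 := Finset.sum_nonneg fun _ _ => sq_nonneg _
  change (∑ u ∈ T, exchange z s t u ^ 2).toNat < (∑ u ∈ T, z u ^ 2).toNat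
  omega

lemma mem_plusPart {z : S → ℤ} {s : S} : s ∈ plusPart T p z ↔
    s ∈ T ∧ ∃ t ∈ T, floorMean T p + 2 ≤ z t ∧ exchange z s t ∈ integralBases T p :=
  by
  classical exact Finset.mem_filter

lemma mem_minusPart {z : S → ℤ} {t : S} : t ∈ minusPart T p z ↔
    t ∈ T ∧ ∃ s ∈ T, z s ≤ floorMean T p - 1 ∧ exchange z s t ∈ integralBases T p :=
  by
  classical exact Finset.mem_filter

lemma mem_zeroPart {z : S → ℤ} {s : S} : s ∈ zeroPart T p z ↔
    s ∈ T ∧ s ∉ plusPart T p z ∧ s ∉ minusPart T p z := by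
  simp [zeroPart]

lemma plusPart_subset (z : S → ℤ) : plusPart T p z ⊆ T := fun _ h => (mem_plusPart.1 h).1

lemma minusPart_subset (z : S → ℤ) : minusPart T p z ⊆ T := fun _ h => (mem_minusPart.1 h).1

namespace IsChoice

variable {z : S → ℤ}

lemma le_of_mem_plusPart (hz : IsChoice T p z) {s : S} (hs : s ∈ plusPart T p z) :
    floorMean T p + 1 ≤ z s := by
  obtain ⟨hsT, t, ht, htz, hex⟩ := mem_plusPart.1 hs
  by_contra! hlt
  exact hz.2 s hsT t ht (by linarith) (by linarith) (by linarith) hex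

lemma le_of_mem_minusPart (hz : IsChoice T p z) {t : S} (ht : t ∈ minusPart T p z) :
    z t ≤ floorMean T p := by
  obtain ⟨htT, s, hs, hsz, hex⟩ := mem_minusPart.1 ht
  by_contra! hlt
  exact hz.2 s hs t htT (by linarith) (by linarith) (by linarith) hex

lemma mem_plusPart_of_le (hz : IsChoice T p z) {t : S} (ht : t ∈ T)
    (h : floorMean T p + 2 ≤ z t) : t ∈ plusPart T p z :=
  mem_plusPart.2 ⟨ht, t, ht, h, by rw [exchange_self]; exact hz.1⟩

lemma mem_minusPart_of_le (hz : IsChoice T p z) {s : S} (hs : s ∈ T)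
    (h : z s ≤ floorMean T p - 1) : s ∈ minusPart T p z :=
  mem_minusPart.2 ⟨hs, s, hs, h, by rw [exchange_self]; exact hz.1⟩

lemma disjoint_parts (hz : IsChoice T p z) : Disjoint (plusPart T p z) (minusPart T p z) := by
  rw [Finset.disjoint_left]
  intro s h1 h2
  linarith [hz.le_of_mem_plusPart h1, hz.le_of_mem_minusPart h2]

lemma isTight_plusPart (hz : IsChoice T p z) (hp : IsSupermodular p) :
    IsTight T p z (plusPart T p z) :=
  isTight_of_mem_iff_exists_exchange (A := T.filter fun t => floorMean T p + 2 ≤ z t) hp hz.1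
    (Finset.filter_subset _ _) fun s => by simp [mem_plusPart, and_assoc]

lemma isTight_sdiff_minusPart (hz : IsChoice T p z) (hp : IsSupermodular p) :
    IsTight T p z (T \ minusPart T p z) :=
  isTight_sdiff_of_mem_iff_exists_exchange (A := T.filter fun s => z s ≤ floorMean T p - 1) hp hz.1
    (Finset.filter_subset _ _) fun s => by simp [mem_minusPart, and_assoc]

lemma sum_bounds (hz : IsChoice T p z) (hT : T.Nonempty) :
    floorMean T p * T.card ≤ ∑ s ∈ T, z s ∧ ∑ s ∈ T, z s < (floorMean T p + 1) * T.card :=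
  floorMean_mul_card_le hz.1.1.symm hT

lemma plusPart_ssubset (hz : IsChoice T p z) (hT : T.Nonempty) : plusPart T p z ⊂ T := by
  refine (plusPart_subset z).ssubset_of_ne fun h => ?_
  have h1 := Finset.card_nsmul_le_sum T z (floorMean T p + 1) fun s hs =>
    hz.le_of_mem_plusPart (h.symm ▸ hs)
  have h2 := (hz.sum_bounds hT).2
  rw [nsmul_eq_mul] at h1
  linarith

lemma minusPart_ssubset (hz : IsChoice T p z) (hT : T.Nonempty) : minusPart T p z ⊂ T := by
  refine (minusPart_subset z).ssubset_of_ne fun h => ?_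
  obtain ⟨t, ht⟩ := hT
  obtain ⟨-, s, hs, hsz, -⟩ := mem_minusPart.1 (h.symm ▸ ht : t ∈ minusPart T p z)
  -- The bound `z ≤ a` alone allows total `a * |T|`; the witness with `z s ≤ a - 1` makes it strict.
  have h1 : ∑ s ∈ T, z s < ∑ _s ∈ T, floorMean T p :=
    Finset.sum_lt_sum (fun u hu => hz.le_of_mem_minusPart (h.symm ▸ hu)) ⟨s, hs, by linarith⟩
  have h2 := (hz.sum_bounds ⟨t, ht⟩).1
  rw [Finset.sum_const, nsmul_eq_mul] at h1
  linarith

lemma isSupermodular_contraction (hz : IsChoice T p z) (hp : IsSupermodular p) :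
    IsSupermodular (contraction T (minusPart T p z) p) :=
  FujishigeDecomposition.isSupermodular_contraction hp (by
    rw [(hz.isTight_sdiff_minusPart hp).2]; exact WithBot.coe_ne_bot)

lemma mem_integralBases_plusPart (hz : IsChoice T p z) (hp : IsSupermodular p) :
    z ∈ integralBases (plusPart T p z) p :=
  mem_integralBases_of_isTight hz.1 (hz.isTight_plusPart hp)

lemma mem_integralBases_minusPart (hz : IsChoice T p z) (hp : IsSupermodular p) :
    z ∈ integralBases (minusPart T p z) (contraction T (minusPart T p z) p) :=
  mem_integralBases_contraction hz.1 (minusPart_subset z) (hz.isTight_sdiff_minusPart hp)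

end IsChoice

theorem terminates (n : ℕ) : ∀ (T : Finset S) (p : Finset S → WithBot ℤ), T.card = n →
    T.Nonempty → IsSupermodular p → p T ≠ ⊥ → Terminates T p := by
  induction n using Nat.strong_induction_on with
  | _ n ih =>
    rintro T p rfl hT hp hpT
    refine .call (exists_isChoice hp hpT) (fun z hz hne => ?_) fun z hz hne => ?_
    · refine ih _ (Finset.card_lt_card (hz.plusPart_ssubset hT)) _ _ rfl hne hp ?_
      rw [(hz.isTight_plusPart hp).2]
      exact WithBot.coe_ne_bot
    · refine ih _ (Finset.card_lt_card (hz.minusPart_ssubset hT)) _ _ rfl hne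
        (hz.isSupermodular_contraction hp) ?_
      rw [← (hz.mem_integralBases_minusPart hp).1]
      exact WithBot.coe_ne_bot

/-- Allows outputs of the two recursive calls to be glued into one vector. -/
lemma IsOutput.congr {zs : S → ℤ} (h : IsOutput T p zs) :
    ∀ {ys : S → ℤ}, (∀ s ∈ T, ys s = zs s) → IsOutput T p ys := by
  induction h with
  | call z choice zero _ _ ihp ihm =>
    intro ys hys
    exact .call z choice (fun s hs => (hys s (mem_zeroPart.1 hs).1).trans (zero s hs))
      (fun hne => ihp hne fun s hs => hys s (plusPart_subset z hs))
      (fun hne => ihm hne fun s hs => hys s (minusPart_subset z hs))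

open Classical in
lemma Terminates.exists_isOutput (h : Terminates T p) : ∃ zs, IsOutput T p zs := by
  induction h with
  | @call T p hex _ _ ihp ihm =>
    obtain ⟨z, hz⟩ := hex
    have hplus : ∃ x, (plusPart T p z).Nonempty → IsOutput (plusPart T p z) p x := by
      by_cases hne : (plusPart T p z).Nonempty
      · exact (ihp z hz hne).imp fun _ hx _ => hx
      · exact ⟨z, fun h => absurd h hne⟩
    have hminus : ∃ x, (minusPart T p z).Nonempty →
        IsOutput (minusPart T p z) (contraction T (minusPart T p z) p) x := by
      by_cases hne : (minusPart T p z).Nonempty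
      · exact (ihm z hz hne).imp fun _ hx _ => hx
      · exact ⟨z, fun h => absurd h hne⟩
    obtain ⟨x, hx⟩ := hplus
    obtain ⟨y, hy⟩ := hminus
    refine ⟨fun s => if s ∈ plusPart T p z then x s else if s ∈ minusPart T p z then y s else z s,
      .call z hz (fun s hs => ?_) (fun hne => (hx hne).congr fun s hs => ?_)
        fun hne => (hy hne).congr fun s hs => ?_⟩
    · obtain ⟨-, h1, h2⟩ := mem_zeroPart.1 hs
      simp [h1, h2]
    · simp [hs]
    · simp [hs, Finset.disjoint_right.1 hz.disjoint_parts hs]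

/-- Bases of the restriction to `S₊` and of the contraction to `S₋`, together with `z` on `S₀`, form
a base for which `S₊` and the complement of `S₋` are tight. -/
lemma IsChoice.mem_integralBases_of_parts {z zs : S → ℤ} (hz : IsChoice T p z)
    (hp : IsSupermodular p) (zero : ∀ s ∈ zeroPart T p z, zs s = z s)
    (plus : zs ∈ integralBases (plusPart T p z) p)
    (minus : zs ∈ integralBases (minusPart T p z) (contraction T (minusPart T p z) p)) :
    zs ∈ integralBases T p ∧ IsTight T p zs (plusPart T p z) ∧
      IsTight T p zs (T \ minusPart T p z) := by
  have tP := hz.isTight_plusPart hp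
  have tM := hz.isTight_sdiff_minusPart hp
  have zM := hz.mem_integralBases_minusPart hp
  have hdis := hz.disjoint_parts
  have hMT := minusPart_subset (p := p) (T := T) z
  have hPsub : plusPart T p z ⊆ T \ minusPart T p z :=
    Finset.subset_sdiff.2 ⟨plusPart_subset z, hdis⟩
  generalize hP : plusPart T p z = P at *
  generalize hM : minusPart T p z = M at *
  have zero' : ∀ s ∈ (T \ M) \ P, zs s = z s := by
    intro s hs
    simp only [Finset.mem_sdiff] at hs
    exact zero s (mem_zeroPart.2 ⟨hs.1.1, by rw [hP]; exact hs.2, by rw [hM]; exact hs.1.2⟩)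
  have sumP : ∑ s ∈ P, zs s = ∑ s ∈ P, z s := WithBot.coe_inj.1 (plus.1.trans tP.2)
  have sumM : ∑ s ∈ M, zs s = ∑ s ∈ M, z s := WithBot.coe_inj.1 (minus.1.trans zM.1.symm)
  have sumTM : ∑ s ∈ T \ M, zs s = ∑ s ∈ T \ M, z s := by
    rw [← Finset.sum_sdiff hPsub, ← Finset.sum_sdiff hPsub, sumP, Finset.sum_congr rfl zero']
  have sumT : ∑ s ∈ T, zs s = ∑ s ∈ T, z s := by
    rw [← Finset.sum_sdiff hMT, ← Finset.sum_sdiff hMT, sumM, sumTM]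
  refine ⟨⟨by rw [sumT]; exact hz.1.1, fun Z hZ => ?_⟩, ⟨tP.1, by rw [sumP]; exact tP.2⟩,
    ⟨tM.1, by rw [sumTM]; exact tM.2⟩⟩
  cases hq : p Z with
  | bot => exact bot_le
  | coe i =>
    -- `Z` is uncrossed with `P`, then `Z ∪ P` with `T \ M`. The resulting sets are bounded by the
    -- restriction, by `z` and by the contraction; `p P` and `p (T \ M)` cancel.
    obtain ⟨k, l, hk, hl, h1⟩ := hp.exists_le hq tP.2
    obtain ⟨k', l', hk', hl', h2⟩ := hp.exists_le hl tM.2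
    have b1 := plus.2 (Z ∩ P) Finset.inter_subset_right
    rw [hk, WithBot.coe_le_coe] at b1
    have b2 := hz.1.2 ((Z ∪ P) ∩ (T \ M)) (Finset.inter_subset_right.trans tM.1)
    rw [hk', WithBot.coe_le_coe] at b2
    have b3 := minus.2 (Z ∩ M) Finset.inter_subset_right
    have e3 : Z ∩ M ∪ T \ M = Z ∪ P ∪ T \ M := by
      ext s
      have := @hZ s
      have := @hPsub s
      simp only [Finset.mem_union, Finset.mem_inter, Finset.mem_sdiff] at *
      tauto
    rw [contraction, e3, hl', tM.2, WithBot.unbotD_coe, WithBot.map_coe, WithBot.coe_le_coe] at b3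
    have e2 : (Z ∪ P) ∩ (T \ M) = (Z ∩ ((T \ M) \ P)) ∪ P := by
      ext s
      have := @hPsub s
      simp only [Finset.mem_union, Finset.mem_inter, Finset.mem_sdiff] at *
      tauto
    have d2 : Disjoint (Z ∩ ((T \ M) \ P)) P :=
      Finset.disjoint_of_subset_left Finset.inter_subset_right Finset.sdiff_disjoint
    rw [e2, Finset.sum_union d2,
      ← Finset.sum_congr rfl fun s hs => zero' s (Finset.mem_inter.1 hs).2] at b2
    have e4 : Z = (Z ∩ P ∪ Z ∩ ((T \ M) \ P)) ∪ Z ∩ M := by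
      ext s
      have := @hZ s
      simp only [Finset.mem_union, Finset.mem_inter, Finset.mem_sdiff] at *
      tauto
    have d4 : Disjoint (Z ∩ P) (Z ∩ ((T \ M) \ P)) :=
      Finset.disjoint_of_subset_left Finset.inter_subset_right
        (Finset.disjoint_of_subset_right Finset.inter_subset_right Finset.disjoint_sdiff)
    have d5 : Disjoint (Z ∩ P ∪ Z ∩ ((T \ M) \ P)) (Z ∩ M) := by
      rw [Finset.disjoint_left]
      intro s
      have := @hPsub s
      simp only [Finset.mem_union, Finset.mem_inter, Finset.mem_sdiff] at *
      tauto
    have e5 : ∑ s ∈ Z, zs s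
        = ∑ s ∈ Z ∩ P, zs s + ∑ s ∈ Z ∩ ((T \ M) \ P), zs s + ∑ s ∈ Z ∩ M, zs s := by
      rw [← Finset.sum_union d4, ← Finset.sum_union d5, ← e4]
    rw [WithBot.coe_le_coe, e5]
    linarith

lemma isLocallyOptimal_empty (hp : IsSupermodular p) (x : S → ℤ) : IsLocallyOptimal ∅ p x := by
  refine ⟨⟨by simp [hp.empty], fun Z hZ => ?_⟩, by simp⟩
  simp [Finset.subset_empty.1 hZ, hp.empty]

theorem IsOutput.isLocallyOptimal {zs : S → ℤ} (h : IsOutput T p zs) :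
    IsSupermodular p → IsLocallyOptimal T p zs := by
  induction h with
  | @call T p zs z hz zero _ _ ihp ihm =>
    intro hp
    have hq := hz.isSupermodular_contraction hp
    have plus : IsLocallyOptimal (plusPart T p z) p zs := by
      rcases (plusPart T p z).eq_empty_or_nonempty with h | h
      · rw [h]; exact isLocallyOptimal_empty hp zs
      · exact ihp h hp
    have minus : IsLocallyOptimal (minusPart T p z) (contraction T (minusPart T p z) p) zs := by
      rcases (minusPart T p z).eq_empty_or_nonempty with h | h
      · rw [h] at hq ⊢; exact isLocallyOptimal_empty hq zs
      · exact ihm h hq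
    -- On each part `z` is itself a base, so its bounds pass to the locally optimal `zs`.
    have geP := plus.ge_of_forall_ge hp (hz.mem_integralBases_plusPart hp)
      fun s hs => hz.le_of_mem_plusPart hs
    have leM := minus.le_of_forall_le hq (hz.mem_integralBases_minusPart hp)
      fun s hs => hz.le_of_mem_minusPart hs
    have bound0 : ∀ s ∈ T, s ∉ plusPart T p z → s ∉ minusPart T p z →
        floorMean T p ≤ zs s ∧ zs s ≤ floorMean T p + 1 := by
      intro s hs h1 h2
      rw [zero s (mem_zeroPart.2 ⟨hs, h1, h2⟩)]
      constructor
      · by_contra! hlt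
        exact h2 (hz.mem_minusPart_of_le hs (by linarith))
      · by_contra! hlt
        exact h1 (hz.mem_plusPart_of_le hs (by linarith))
    obtain ⟨hzs, tP, tM⟩ := hz.mem_integralBases_of_parts hp zero plus.1 minus.1
    have geOff : ∀ s ∈ T, s ∉ minusPart T p z → floorMean T p ≤ zs s := by
      intro s hs hsM
      by_cases hsP : s ∈ plusPart T p z
      · linarith [geP s hsP]
      · exact (bound0 s hs hsP hsM).1
    refine ⟨hzs, fun s hs t ht hst hex => ?_⟩
    have closed := (exchange_mem_iff hzs hs ht).1 hex
    by_cases htP : t ∈ plusPart T p z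
    · have hsP := closed _ tP htP
      -- With both `s` and `t` in `S₊`, its sum is unchanged and the exchanged vector restricts to a
      -- base there.
      refine plus.2 s hsP t htP hst (mem_integralBases_of_isTight hex ⟨tP.1, ?_⟩)
      rw [tP.2, sum_exchange]
      simp [hsP, htP]
    by_cases htM : t ∈ minusPart T p z
    · by_cases hsM : s ∈ minusPart T p z
      · refine minus.2 s hsM t htM hst
          (mem_integralBases_contraction hex (minusPart_subset z) ⟨tM.1, ?_⟩)
        rw [tM.2, sum_exchange]
        simp [hsM, htM]
      · linarith [geOff s hs hsM, leM t htM]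
    · have hsM := (Finset.mem_sdiff.1 (closed _ tM (Finset.mem_sdiff.2 ⟨ht, htM⟩))).2
      linarith [geOff s hs hsM, (bound0 t ht htP htM).2]

end Algorithm

end FujishigeDecomposition

theorem proposition5p8 {S : Type*} [Fintype S] [DecidableEq S] [Nonempty S]
    (p : Finset S → WithBot ℤ) (hp : FujishigeDecomposition.IsSupermodular p)
    (hS : p Finset.univ ≠ ⊥) :
    FujishigeDecomposition.Terminates Finset.univ p ∧
    (∃ zs : S → ℤ, FujishigeDecomposition.IsOutput Finset.univ p zs) ∧
    ∀ zs : S → ℤ, FujishigeDecomposition.IsOutput Finset.univ p zs →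
      FujishigeDecomposition.IsSquareSumMin
        (FujishigeDecomposition.integralBases Finset.univ p) zs ∧
      FujishigeDecomposition.IsDecMin
        (FujishigeDecomposition.integralBases Finset.univ p) zs := by
  have hterm := FujishigeDecomposition.terminates _ Finset.univ p rfl Finset.univ_nonempty hp hS
  refine ⟨hterm, hterm.exists_isOutput, fun zs hzs => ?_⟩
  have hopt := hzs.isLocallyOptimal hp
  exact ⟨hopt.isSquareSumMin hp, hopt.isDecMin hp⟩
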